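/- Let $X=Y=\{0,1\}^n$ and let $\mathrm{EQ}_n(x,y)=1$ if $x=y$ and $0$ otherwise. For $k\ge 0$, in the direct-sum problem $\times_k\mathrm{EQ}_n$ Alice holds $(x_1,\dots,x_k)$ and Bob holds $(y_1,\dots,y_k)$, with $x_i,y_i\in\{0,1\}^n$, and they must compute the whole vector $(\mathrm{EQ}_n(x_1,y_1),\dots,\mathrm{EQ}_n(x_k,y_k))\in\{0,1\}^k$. A deterministic protocol is a binary tree in which each internal node carries a $\{0,1\}$-valued function of Alice's input alone or of Bob's input alone (which determines the child to move to) and each leaf carries an output; its height is the maximal number of bits sent. A public-coin protocol is a probability distribution on deterministic protocols, and its height is the maximum height of a tree in its support. For $0<\varepsilon<1/2$ let $R^{pub}_\varepsilon(f)$ be the minimum height of a public-coin protocol which, on every input pair, outputs the value of $f$ with probability at least $1-\varepsilon$; $R^{pub}=R^{pub}_{1/3}$. **Theorem.** $R^{pub}(\times_k \mathrm{EQ}_n)=\Theta(k)$, uniformly in $n\ge 1$. More precisely, for every $0<\varepsilon<1/2$ there is a constant $C$, depending only on $\varepsilon$, such that for all $n,k\ge 0$ $$R^{pub}_\varepsilon(\times_k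 \mathrm{EQ}_n)\le C\,k,$$ and for all $n\ge 1$, $k\ge 0$ $$R^{pub}_\varepsilon(\times_k \mathrm{EQ}_n)\ge k .$$ -/

import Mathlib

namespace CommComplexity

open scoped ENNReal

/-- A deterministic two-party protocol: a binary tree whose leaves carry an output in `Z` and each
of whose internal nodes carries a function `X → {0,1}` (Alice sends this bit of her input) or a
function `Y → {0,1}` (Bob sends this bit of his input). -/
inductive Protocol (X Y Z : Type) : Type
  | leaf (z : Z) : Protocol X Y Z
  | alice (bit : X → Bool) (child : Bool → Protocol X Y Z) : Protocol X Y Z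
  | bob (bit : Y → Bool) (child : Bool → Protocol X Y Z) : Protocol X Y Z

/-- The label of the leaf reached from the root on the input pair `(x, y)`. -/
def Protocol.eval {X Y Z : Type} (x : X) (y : Y) : Protocol X Y Z → Z
  | .leaf z => z
  | .alice bit child => (child (bit x)).eval x y
  | .bob bit child => (child (bit y)).eval x y

/-- The height of the tree: the maximal number of bits sent on a path from the root to a leaf. -/
def Protocol.height {X Y Z : Type} : Protocol X Y Z → ℕ
  | .leaf _ => 0
  | .alice _ child => max (child false).height (child true).height + 1
  | .bob _ child => max (child false).height (child true).height + 1

/-- A public-coin randomized protocol: once the public random string is fixed the players follow a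
deterministic protocol, so this is a probability distribution on deterministic protocols. -/
abbrev PublicCoinProtocol (X Y Z : Type) : Type := PMF (Protocol X Y Z)

/-- On every input pair, the probability over the public coins of a wrong output is at most `ε`. -/
def PublicCoinProtocol.ComputesWithError {X Y Z : Type} (P : PublicCoinProtocol X Y Z)
    (f : X → Y → Z) (ε : ℝ) : Prop :=
  ∀ (x : X) (y : Y), P.toOuterMeasure {T | T.eval x y ≠ f x y} ≤ ENNReal.ofReal ε

/-- Worst-case height over all outcomes of the public coins (infinite if unbounded). -/
noncomputable def PublicCoinProtocol.height {X Y Z : Type} (P : PublicCoinProtocol X Y Z) : ℕ∞ :=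
  ⨆ T ∈ P.support, (T.height : ℕ∞)

/-- `Rpub ε f` is the minimum height of a public-coin randomized protocol that computes `f` with
two-sided error at most `ε`; it is `⊤` if there is no such protocol of bounded height. -/
noncomputable def Rpub {X Y Z : Type} (ε : ℝ) (f : X → Y → Z) : ℕ∞ :=
  ⨅ (P : PublicCoinProtocol X Y Z) (_ : P.ComputesWithError f ε), P.height

/-- The equality function on `n`-bit strings. -/
def EQ (n : ℕ) (x y : Fin n → Bool) : Bool := decide (x = y)

/-- The direct sum `×ₖ f`: Alice holds `(x₁, …, xₖ)`, Bob holds `(y₁, …, yₖ)`, and the output is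
the tuple of all the values `f (xᵢ, yᵢ)`. -/
def directSum {X Y Z : Type} (k : ℕ) (f : X → Y → Z) (x : Fin k → X) (y : Fin k → Y) :
    Fin k → Z :=
  fun i => f (x i) (y i)

end CommComplexity

namespace CommComplexity

open scoped ENNReal NNReal Classical

noncomputable section

/-! ### Operations on deterministic protocols -/

namespace Protocol

variable {X Y Z W X' Y' : Type}

/-! Upper bound: testing each coordinate separately with error about `1 / k` would cost an extra
factor `log k`. Instead one keeps protocols with small expected cost and one-sided error: equal
coordinates are always recognized. A wrong output then claims equality at some unequal coordinate,
so a single constant-cost hash test of the two tuples, restricted to the coordinates claimed equal,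
detects it with constant probability. Combining two halves doubles the error `e`; testing and
rerunning upon rejection (`HasScheme.verify`) multiplies it by a small constant. Thus `e` at least
halves when the size doubles. A rerun happens with probability at most `2 * e`, so each merge adds
only a bounded overhead, and these overheads sum to a linear expected cost
(`exists_hasScheme_two_pow`). Truncation then bounds the height.

Lower bound: fix Alice's input so that all `2 ^ k` outputs occur as Bob's varies. A tree of height
below `k` has at most `2 ^ (k - 1)` outputs, hence is right on at most half of these inputs;
averaging contradicts `ε < 1 / 2`. -/

/-- The number of bits sent on the input pair `(x, y)`. -/
def cost (x : X) (y : Y) : Protocol X Y Z → ℕ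
  | .leaf _ => 0
  | .alice bit child => (child (bit x)).cost x y + 1
  | .bob bit child => (child (bit y)).cost x y + 1

/-- Sequential composition: continue with a protocol that depends on the output so far. -/
def andThen (q : Z → Protocol X Y W) : Protocol X Y Z → Protocol X Y W
  | .leaf z => q z
  | .alice bit child => .alice bit fun b => (child b).andThen q
  | .bob bit child => .bob bit fun b => (child b).andThen q

/-- Both players apply a function to their input before they follow the protocol. -/
def comap (f : X' → X) (g : Y' → Y) : Protocol X Y Z → Protocol X' Y' Z
  | .leaf z => .leaf z
  | .alice bit child => .alice (fun x => bit (f x)) fun b => (child b).comap f g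
  | .bob bit child => .bob (fun y => bit (g y)) fun b => (child b).comap f g

/-- Stop after `H` bits, with the default output `d`. -/
def truncate (d : Z) : ℕ → Protocol X Y Z → Protocol X Y Z
  | _, .leaf z => .leaf z
  | 0, .alice _ _ => .leaf d
  | 0, .bob _ _ => .leaf d
  | H + 1, .alice bit child => .alice bit fun b => (child b).truncate d H
  | H + 1, .bob bit child => .bob bit fun b => (child b).truncate d H

@[simp] theorem eval_leaf (x : X) (y : Y) (z : Z) : (leaf z).eval x y = z := rfl

@[simp] theorem cost_leaf (x : X) (y : Y) (z : Z) : (leaf z).cost x y = 0 := rfl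

@[simp] theorem eval_andThen (x : X) (y : Y) (q : Z → Protocol X Y W) (T : Protocol X Y Z) :
    (T.andThen q).eval x y = (q (T.eval x y)).eval x y := by
  induction T with
  | leaf z => rfl
  | alice bit child ih => exact ih _
  | bob bit child ih => exact ih _

@[simp] theorem cost_andThen (x : X) (y : Y) (q : Z → Protocol X Y W) (T : Protocol X Y Z) :
    (T.andThen q).cost x y = T.cost x y + (q (T.eval x y)).cost x y := by
  induction T with
  | leaf z => simp [andThen]
  | alice bit child ih => simp only [andThen, cost, eval, ih]; omega
  | bob bit child ih => simp only [andThen, cost, eval, ih]; omega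

@[simp] theorem eval_comap (f : X' → X) (g : Y' → Y) (x : X') (y : Y') (T : Protocol X Y Z) :
    (T.comap f g).eval x y = T.eval (f x) (g y) := by
  induction T with
  | leaf z => rfl
  | alice bit child ih => exact ih _
  | bob bit child ih => exact ih _

@[simp] theorem cost_comap (f : X' → X) (g : Y' → Y) (x : X') (y : Y') (T : Protocol X Y Z) :
    (T.comap f g).cost x y = T.cost (f x) (g y) := by
  induction T with
  | leaf z => rfl
  | alice bit child ih => exact congrArg (· + 1) (ih _)
  | bob bit child ih => exact congrArg (· + 1) (ih _)

theorem height_truncate_le (d : Z) (H : ℕ) (T : Protocol X Y Z) :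
    (T.truncate d H).height ≤ H := by
  induction T generalizing H with
  | leaf z => cases H <;> simp [truncate, height]
  | alice bit child ih => cases H <;> simp [truncate, height, ih]
  | bob bit child ih => cases H <;> simp [truncate, height, ih]

theorem eval_truncate (d : Z) (x : X) (y : Y) (H : ℕ) (T : Protocol X Y Z)
    (h : T.cost x y ≤ H) : (T.truncate d H).eval x y = T.eval x y := by
  induction T generalizing H with
  | leaf z => cases H <;> rfl
  | alice bit child ih =>
    cases H with
    | zero => simp [cost] at h
    | succ H => exact ih _ _ (Nat.le_of_succ_le_succ h)
  | bob bit child ih =>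
    cases H with
    | zero => simp [cost] at h
    | succ H => exact ih _ _ (Nat.le_of_succ_le_succ h)

/-- A protocol of height `h` has at most `2 ^ h` different outputs. -/
theorem exists_finset_outputs (T : Protocol X Y Z) :
    ∃ L : Finset Z, L.card ≤ 2 ^ T.height ∧ ∀ x y, T.eval x y ∈ L := by
  have node : ∀ child : Bool → Protocol X Y Z,
      (∀ b, ∃ L : Finset Z, L.card ≤ 2 ^ (child b).height ∧ ∀ x y, (child b).eval x y ∈ L) →
      ∃ L : Finset Z, L.card ≤ 2 ^ (max (child false).height (child true).height + 1) ∧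
        ∀ b x y, (child b).eval x y ∈ L := by
    intro child ih
    choose L hL hmem using ih
    refine ⟨L false ∪ L true, ?_, ?_⟩
    · have h0 := (hL false).trans (Nat.pow_le_pow_right two_pos
        (le_max_left _ (child true).height))
      have h1 := (hL true).trans (Nat.pow_le_pow_right two_pos
        (le_max_right (child false).height _))
      have := Finset.card_union_le (L false) (L true)
      rw [pow_succ]
      omega
    · rintro (_ | _) x y
      · exact Finset.mem_union_left _ (hmem _ _ _)
      · exact Finset.mem_union_right _ (hmem _ _ _)
  induction T with
  | leaf z => exact ⟨{z}, by simp [height], by simp⟩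
  | alice bit child ih =>
    obtain ⟨L, hL, hmem⟩ := node child ih
    exact ⟨L, hL, fun x y => hmem _ x y⟩
  | bob bit child ih =>
    obtain ⟨L, hL, hmem⟩ := node child ih
    exact ⟨L, hL, fun x y => hmem _ x y⟩

end Protocol

/-! ### Expectations of nonnegative functions -/

/-- The expectation of `g` under the distribution `p`. -/
def expect {A : Type} (p : PMF A) (g : A → ℝ≥0∞) : ℝ≥0∞ := ∑' a, p a * g a

section Expect

variable {A B : Type}

theorem expect_mono {p : PMF A} {g h : A → ℝ≥0∞} (H : ∀ a ∈ p.support, g a ≤ h a) :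
    expect p g ≤ expect p h := by
  refine ENNReal.tsum_le_tsum fun a => ?_
  by_cases ha : p a = 0
  · simp [ha]
  · gcongr
    exact H a ha

@[simp] theorem expect_pure (a : A) (g : A → ℝ≥0∞) : expect (PMF.pure a) g = g a := by
  rw [expect, tsum_eq_single a]
  · simp
  · intro b hb
    simp [hb]

@[simp] theorem expect_bind (p : PMF A) (q : A → PMF B) (g : B → ℝ≥0∞) :
    expect (p.bind q) g = expect p fun a => expect (q a) g := by
  simp only [expect, PMF.bind_apply, ← ENNReal.tsum_mul_right, ← ENNReal.tsum_mul_left]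
  rw [ENNReal.tsum_comm]
  simp only [mul_assoc]

@[simp] theorem expect_map (p : PMF A) (f : A → B) (g : B → ℝ≥0∞) :
    expect (p.map f) g = expect p fun a => g (f a) := by
  simp [PMF.map]

@[simp] theorem expect_const (p : PMF A) (c : ℝ≥0∞) : expect p (fun _ => c) = c := by
  rw [expect, ENNReal.tsum_mul_right, p.tsum_coe, one_mul]

theorem expect_add (p : PMF A) (g h : A → ℝ≥0∞) :
    expect p (fun a => g a + h a) = expect p g + expect p h := by
  simp only [expect, mul_add, ENNReal.tsum_add]

theorem expect_mul_const (p : PMF A) (g : A → ℝ≥0∞) (c : ℝ≥0∞) :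
    expect p (fun a => g a * c) = expect p g * c := by
  simp only [expect, ← mul_assoc, ENNReal.tsum_mul_right]

theorem expect_const_mul (p : PMF A) (g : A → ℝ≥0∞) (c : ℝ≥0∞) :
    expect p (fun a => c * g a) = c * expect p g := by
  simp only [mul_comm c, expect_mul_const]

theorem expect_sum {ι : Type} (s : Finset ι) (p : PMF A) (g : ι → A → ℝ≥0∞) :
    expect p (fun a => ∑ i ∈ s, g i a) = ∑ i ∈ s, expect p (g i) := by
  simp only [expect, Finset.mul_sum]
  exact Summable.tsum_finsetSum fun _ _ => ENNReal.summable

theorem toOuterMeasure_eq_expect (p : PMF A) (s : Set A) :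
    p.toOuterMeasure s = expect p fun a => if a ∈ s then 1 else 0 := by
  rw [PMF.toOuterMeasure_apply, expect]
  congr 1 with a
  by_cases h : a ∈ s <;> simp [h]

end Expect

/-! ### Testing equality by random hashing -/

/-- A uniformly random Boolean function takes equal values at two given points with probability
one half. -/
theorem expect_uniform_hash {V : Type} [Fintype V] {u v : V} (huv : u ≠ v) :
    expect (PMF.uniformOfFintype (V → Bool)) (fun h => if h u = h v then 1 else 0) = 2⁻¹ := by
  set p := PMF.uniformOfFintype (V → Bool)
  set g : (V → Bool) → ℝ≥0∞ := fun h => if h u = h v then 1 else 0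
  -- Flipping the hash at `u` preserves the uniform distribution and exchanges collision with
  -- non-collision.
  let flip : (V → Bool) → V → Bool := fun h => Function.update h u (!h u)
  have hflip : Function.Involutive flip := by
    intro h
    simp [flip]
  have h1 : expect p (fun h => g (flip h)) = expect p g := by
    simp only [expect]
    rw [← (hflip.toPerm flip).tsum_eq (fun h => p h * g h)]
    simp [p]
  have h2 : expect p (fun h => g h + g (flip h)) = 1 := by
    rw [← expect_const p 1]
    congr 1 with h
    cases hu : h u <;> cases hv : h v <;> simp [g, flip, hu, hv, huv.symm]
  rw [expect_add, h1, ← two_mul] at h2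
  exact ENNReal.eq_inv_of_mul_eq_one_left (by rwa [mul_comm] at h2)

/-- A public-coin equality test of height `2 * t` that never rejects equal inputs and accepts
different inputs with probability at most `2 ^ (-t)`. -/
theorem exists_equality_test (V : Type) [Fintype V] (t : ℕ) :
    ∃ Q : PMF (Protocol V V Bool),
      (∀ T ∈ Q.support, (∀ u, T.eval u u = true) ∧ ∀ u v, T.cost u v ≤ 2 * t) ∧
      ∀ u v, u ≠ v → expect Q (fun T => if T.eval u v = true then 1 else 0) ≤ 2⁻¹ ^ t := by
  induction t with
  | zero =>
    refine ⟨PMF.pure (.leaf true), ?_, ?_⟩ <;> simp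
  | succ t ih =>
    obtain ⟨Q, hQ, herr⟩ := ih
    refine ⟨(PMF.uniformOfFintype (V → Bool)).bind fun h => Q.map fun S =>
      .alice h fun a => .bob h fun b => if a = b then S else .leaf false, ?_, ?_⟩
    · intro T hT
      simp only [PMF.mem_support_bind_iff, PMF.mem_support_map_iff] at hT
      obtain ⟨h, -, S, hS, rfl⟩ := hT
      refine ⟨fun u => by simpa [Protocol.eval] using (hQ S hS).1 u, fun u v => ?_⟩
      have := (hQ S hS).2 u v
      simp only [Protocol.cost]
      split_ifs
      · omega
      · simp only [Protocol.cost_leaf]; omega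
    · intro u v huv
      rw [expect_bind]
      calc _ ≤ expect (PMF.uniformOfFintype (V → Bool))
            (fun h => (if h u = h v then 1 else 0) * 2⁻¹ ^ t) := by
            refine expect_mono fun h _ => ?_
            rw [expect_map]
            by_cases hh : h u = h v
            · simpa [Protocol.eval, hh] using herr u v huv
            · simp [Protocol.eval, hh]
        _ = _ := by rw [expect_mul_const, expect_uniform_hash huv, pow_succ, mul_comm]

/-! ### One-sided protocols for the direct sum of equality -/

section Scheme

variable {α : Type}

/-- Coordinatewise equality of two tuples. -/
def eqVec {ι : Type} (x y : ι → α) (i : ι) : Bool := decide (x i = y i)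

/-- The indicator of a wrong output of `T` on `(x, y)`. -/
def wrong {ι : Type} (x y : ι → α) (T : Protocol (ι → α) (ι → α) (ι → Bool)) : ℝ≥0∞ :=
  if T.eval x y = eqVec x y then 0 else 1

theorem wrong_of_ne {ι : Type} {x y : ι → α} {T : Protocol (ι → α) (ι → α) (ι → Bool)}
    (h : T.eval x y ≠ eqVec x y) : wrong x y T = 1 :=
  if_neg h

theorem wrong_le_one {ι : Type} (x y : ι → α) (T : Protocol (ι → α) (ι → α) (ι → Bool)) :
    wrong x y T ≤ 1 := by
  unfold wrong
  split_ifs <;> simp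

theorem wrong_congr {ι : Type} {x y : ι → α} {S T : Protocol (ι → α) (ι → α) (ι → Bool)}
    (h : S.eval x y = T.eval x y) : wrong x y S = wrong x y T := by
  simp only [wrong, h]

/-- Coordinatewise equality of `ι`-tuples over `α` has a public-coin protocol that always
recognizes equal coordinates, is wrong with probability at most `e`, and has expected cost at
most `c`. -/
def HasScheme (α ι : Type) (e c : ℝ≥0) : Prop :=
  ∃ P : PMF (Protocol (ι → α) (ι → α) (ι → Bool)),
    (∀ T ∈ P.support, ∀ x y i, x i = y i → T.eval x y i = true) ∧
    (∀ x y, expect P (wrong x y) ≤ e) ∧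
    ∀ x y, expect P (fun T => (T.cost x y : ℝ≥0∞)) ≤ c

theorem hasScheme_unit [Fintype α] (t : ℕ) : HasScheme α Unit (2⁻¹ ^ t) (2 * t) := by
  obtain ⟨Q, hQ, herr⟩ := exists_equality_test α t
  refine ⟨Q.map fun T => (T.comap (fun x => x ()) (fun y => y ())).andThen
    fun b => .leaf fun _ => b, ?_, ?_, ?_⟩
  · intro T hT x y i hi
    simp only [PMF.mem_support_map_iff] at hT
    obtain ⟨S, hS, rfl⟩ := hT
    have hi' : x () = y () := hi
    simp [hi', (hQ S hS).1]
  · intro x y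
    rw [expect_map]
    by_cases hxy : x () = y ()
    · refine le_trans (expect_mono (h := fun _ => 0) fun S hS => ?_) (by simp)
      have : (fun _ : Unit => true) = eqVec x y := by
        funext i
        simp [eqVec, show x i = y i from hxy]
      simp [wrong, hxy, (hQ S hS).1, this]
    · refine le_trans (expect_mono fun S hS => ?_) ((herr _ _ hxy).trans
        (by rw [ENNReal.coe_pow, ENNReal.coe_inv two_ne_zero, ENNReal.coe_ofNat]))
      cases hb : S.eval (x ()) (y ())
      · have : (fun _ : Unit => false) = eqVec x y := by
          funext i
          simp [eqVec, show ¬ x i = y i from hxy]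
        simp [wrong, hb, this]
      · simp only [wrong]
        split_ifs <;> simp
  · intro x y
    rw [expect_map]
    refine le_trans (expect_mono (h := fun _ => (2 * t : ℝ≥0∞)) fun S hS => ?_) (by simp)
    simpa using (Nat.cast_le (α := ℝ≥0∞)).2 ((hQ S hS).2 (x ()) (y ()))

/-- Padding with a default value reduces a smaller index set to a larger one; a correct padded
output restricts to a correct output. -/
theorem HasScheme.comap [Inhabited α] {ι κ : Type} {e c : ℝ≥0} (h : HasScheme α ι e c)
    (f : κ ↪ ι) : HasScheme α κ e c := by
  obtain ⟨P, hP, herr, hcost⟩ := h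
  let pad : (κ → α) → ι → α := fun x => Function.extend f x default
  have hpad : ∀ x j, pad x (f j) = x j := fun x j => f.injective.extend_apply _ _ _
  refine ⟨P.map fun T => (T.comap pad pad).andThen fun z => .leaf fun j => z (f j), ?_, ?_, ?_⟩
  · intro T hT x y j hj
    simp only [PMF.mem_support_map_iff] at hT
    obtain ⟨S, hS, rfl⟩ := hT
    simpa using hP S hS (pad x) (pad y) (f j) (by rw [hpad, hpad, hj])
  · intro x y
    rw [expect_map]
    refine le_trans (expect_mono fun S _ => ?_) (herr (pad x) (pad y))
    by_cases hS : S.eval (pad x) (pad y) = eqVec (pad x) (pad y)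
    · have : (fun j => eqVec (pad x) (pad y) (f j)) = eqVec x y := by
        funext j
        simp [eqVec, hpad]
      simp [wrong, hS, this]
    · rw [wrong_of_ne hS]
      exact wrong_le_one _ _ _
  · intro x y
    rw [expect_map]
    simpa using hcost (pad x) (pad y)

/-- Run protocols for the two halves of the coordinates one after the other. -/
theorem HasScheme.sum {ι κ : Type} {e c e' c' : ℝ≥0} (h : HasScheme α ι e c)
    (h' : HasScheme α κ e' c') : HasScheme α (ι ⊕ κ) (e + e') (c + c') := by
  obtain ⟨P, hP, herr, hcost⟩ := h
  obtain ⟨P', hP', herr', hcost'⟩ := h'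
  refine ⟨P.bind fun T => P'.map fun T' =>
    (T.comap (fun x i => x (.inl i)) (fun y i => y (.inl i))).andThen fun z =>
    (T'.comap (fun x i => x (.inr i)) (fun y i => y (.inr i))).andThen fun z' =>
    .leaf (Sum.elim z z'), ?_, ?_, ?_⟩
  · intro T hT x y i hi
    simp only [PMF.mem_support_bind_iff, PMF.mem_support_map_iff] at hT
    obtain ⟨S, hS, S', hS', rfl⟩ := hT
    cases i with
    | inl i => simpa using hP S hS _ _ i hi
    | inr i => simpa using hP' S' hS' _ _ i hi
  · intro x y
    rw [expect_bind]
    simp only [expect_map]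
    have key : ∀ (S : Protocol (ι → α) (ι → α) (ι → Bool))
        (S' : Protocol (κ → α) (κ → α) (κ → Bool)),
        wrong x y ((S.comap (fun x i => x (.inl i)) (fun y i => y (.inl i))).andThen fun z =>
          (S'.comap (fun x i => x (.inr i)) (fun y i => y (.inr i))).andThen fun z' =>
          .leaf (Sum.elim z z')) ≤
        wrong (fun i => x (.inl i)) (fun i => y (.inl i)) S +
          wrong (fun i => x (.inr i)) (fun i => y (.inr i)) S' := by
      intro S S'
      by_cases h1 : S.eval (fun i => x (.inl i)) (fun i => y (.inl i)) =
          eqVec (fun i => x (.inl i)) (fun i => y (.inl i))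
      · by_cases h2 : S'.eval (fun i => x (.inr i)) (fun i => y (.inr i)) =
            eqVec (fun i => x (.inr i)) (fun i => y (.inr i))
        · have : Sum.elim (eqVec (fun i => x (.inl i)) (fun i => y (.inl i)))
              (eqVec (fun i => x (.inr i)) (fun i => y (.inr i))) = eqVec x y := by
            funext i
            cases i <;> rfl
          simp [wrong, h1, h2, this]
        · rw [wrong_of_ne h2]
          exact (wrong_le_one _ _ _).trans le_add_self
      · rw [wrong_of_ne h1]
        exact (wrong_le_one _ _ _).trans le_self_add
    refine (expect_mono fun S _ => expect_mono fun S' _ => key S S').trans ?_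
    simp only [expect_add, expect_const]
    push_cast
    exact add_le_add (herr _ _) (herr' _ _)
  · intro x y
    rw [expect_bind]
    simp only [expect_map, Protocol.cost_andThen, Protocol.cost_comap, Protocol.cost_leaf,
      add_zero, Nat.cast_add, expect_add, expect_const]
    push_cast
    exact add_le_add (hcost _ _) (hcost' _ _)

/-- Verify the output with a `t`-fold equality test of the coordinates claimed equal, and run the
protocol once more if the test rejects. -/
theorem HasScheme.verify [Fintype α] [Inhabited α] {ι : Type} [Fintype ι] {e c : ℝ≥0}
    (h : HasScheme α ι e c) (t : ℕ) :
    HasScheme α ι (e * (2⁻¹ ^ t + e)) (c + 2 * t + e * c) := by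
  obtain ⟨P, hP, herr, hcost⟩ := h
  obtain ⟨Q, hQ, hQerr⟩ := exists_equality_test (ι → α) t
  let mask : (ι → Bool) → (ι → α) → ι → α := fun z x i => if z i = true then x i else default
  have mask_of_eq : ∀ x y, mask (eqVec x y) x = mask (eqVec x y) y := by
    intro x y
    funext i
    by_cases hi : x i = y i <;> simp [mask, eqVec, hi]
  -- One-sidedness enters here: a wrong `z` can only err by claiming equality where the coordinates
  -- differ, and the mask keeps that coordinate.
  have mask_of_ne : ∀ x y z, (∀ i, x i = y i → z i = true) → z ≠ eqVec x y →
      mask z x ≠ mask z y := by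
    intro x y z hz hne heq
    refine hne (funext fun i => ?_)
    by_cases hi : x i = y i
    · simp [eqVec, hi, hz i hi]
    · have := congrFun heq i
      cases hzi : z i
      · simp [eqVec, hi]
      · simp [mask, hzi, hi] at this
  have accept : ∀ S ∈ Q.support, ∀ x y,
      S.eval (mask (eqVec x y) x) (mask (eqVec x y) y) = true := by
    intro S hS x y
    rw [mask_of_eq]
    exact (hQ S hS).1 _
  let comp : Protocol (ι → α) (ι → α) (ι → Bool) → Protocol (ι → α) (ι → α) Bool →
      Protocol (ι → α) (ι → α) (ι → Bool) → Protocol (ι → α) (ι → α) (ι → Bool) :=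
    fun T S T' => T.andThen fun z => (S.comap (mask z) (mask z)).andThen fun b =>
      if b = true then .leaf z else T'
  refine ⟨P.bind fun T => Q.bind fun S => P.map fun T' => comp T S T', ?_, ?_, ?_⟩
  · intro T hT x y i hi
    simp only [PMF.mem_support_bind_iff, PMF.mem_support_map_iff] at hT
    obtain ⟨T, hT, S, hS, T', hT', rfl⟩ := hT
    simp only [comp, Protocol.eval_andThen, Protocol.eval_comap]
    split_ifs
    · exact hP T hT x y i hi
    · exact hP T' hT' x y i hi
  · intro x y
    simp only [expect_bind, expect_map]
    -- Correct outputs are always accepted. A final error thus needs `T` wrong and then,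
    -- independently, either a false acceptance or a wrong rerun.
    calc _ ≤ expect P fun T => wrong x y T * (2⁻¹ ^ t + e) := by
          refine expect_mono fun T hT => ?_
          by_cases hw : T.eval x y = eqVec x y
          · have : ∀ S ∈ Q.support, ∀ T' ∈ P.support, wrong x y (comp T S T') ≤ 0 := by
              intro S hS T' _
              simp [wrong, comp, hw, accept S hS]
            refine le_trans (expect_mono fun S hS => expect_mono fun T' hT' =>
              this S hS T' hT') ?_
            simp
          · have : ∀ S T', wrong x y (comp T S T') ≤
                (if S.eval (mask (T.eval x y) x) (mask (T.eval x y) y) = true then 1 else 0) +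
                  wrong x y T' := by
              intro S T'
              by_cases hs : S.eval (mask (T.eval x y) x) (mask (T.eval x y) y) = true
              · rw [if_pos hs]
                exact (wrong_le_one _ _ _).trans le_self_add
              · rw [if_neg hs, zero_add, wrong_congr (T := T')]
                simp [comp, hs]
            refine le_trans (expect_mono fun S _ => expect_mono fun T' _ => this S T') ?_
            simp only [expect_add, expect_const]
            rw [wrong, if_neg hw, one_mul]
            exact add_le_add (hQerr _ _ (mask_of_ne _ _ _ (hP T hT x y) hw)) (herr x y)
      _ ≤ e * (2⁻¹ ^ t + e) := by
          rw [expect_mul_const]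
          gcongr
          exact herr x y
      _ = _ := by
          push_cast
          simp
  · intro x y
    simp only [expect_bind, expect_map]
    -- The rerun is paid for only when `T` is wrong.
    calc _ ≤ expect P fun T => (T.cost x y : ℝ≥0∞) + 2 * t + wrong x y T * c := by
          refine expect_mono fun T hT => ?_
          have key : ∀ S ∈ Q.support, ∀ T' ∈ P.support, ((comp T S T').cost x y : ℝ≥0∞) ≤
              (T.cost x y : ℝ≥0∞) + 2 * t + wrong x y T * (T'.cost x y : ℝ≥0∞) := by
            intro S hS T' _
            have h2 : ((S.cost (mask (T.eval x y) x) (mask (T.eval x y) y) : ℕ) : ℝ≥0∞) ≤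
                2 * t := by exact_mod_cast (hQ S hS).2 _ _
            simp only [comp, Protocol.cost_andThen, Protocol.cost_comap, Protocol.eval_comap,
              Nat.cast_add, ← add_assoc]
            refine add_le_add (add_le_add le_rfl h2) ?_
            by_cases hw : T.eval x y = eqVec x y
            · simp [hw, accept S hS]
            · simp only [wrong, hw, if_false, one_mul]
              split_ifs <;> simp
          refine le_trans (expect_mono fun S hS => expect_mono fun T' hT' =>
            key S hS T' hT') ?_
          simp only [expect_add, expect_const, expect_const_mul]
          gcongr
          exact hcost x y
      _ ≤ c + 2 * t + e * c := by
          simp only [expect_add, expect_const, expect_mul_const]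
          gcongr
          · exact hcost x y
          · exact herr x y
      _ = _ := by
          push_cast
          rfl

/-- Induction by doubling. The slack `2 * t + 16` on the left of the cost bound absorbs the overhead
of each merge; `5 ≤ t` ensures `e ≤ 1 / 32` throughout. -/
theorem exists_hasScheme_two_pow [Fintype α] [Inhabited α] {t : ℕ} (ht : 5 ≤ t) (j : ℕ) :
    ∃ e c : ℝ≥0, HasScheme α (Fin (2 ^ j)) e c ∧ e * 2 ^ j ≤ 2⁻¹ ^ t ∧
      c + (2 * t + 16) ≤ 2 * (2 * t + 16) * 2 ^ j := by
  have hδ : (2⁻¹ : ℝ≥0) ^ t ≤ 1 / 32 :=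
    (pow_le_pow_of_le_one (by norm_num) (by norm_num) ht).trans (by norm_num)
  induction j with
  | zero =>
    refine ⟨_, _, (hasScheme_unit t).comap ⟨fun _ => (), fun a b _ => ?_⟩, by simp, ?_⟩
    · exact Subsingleton.elim (α := Fin 1) a b
    · rw [← NNReal.coe_le_coe]
      push_cast
      linarith
  | succ j ih =>
    obtain ⟨e, c, h, he, hc⟩ := ih
    obtain ⟨f⟩ : Nonempty (Fin (2 ^ (j + 1)) ↪ Fin (2 ^ j) ⊕ Fin (2 ^ j)) :=
      Function.Embedding.nonempty_of_card_le (by simp [pow_succ, mul_two])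
    -- Four rounds suffice: `2 * e ≤ 1 / 16` and `2⁻¹ ^ 4 = 1 / 16`, so the new error is at most `2
    -- * e * (1 / 8) ≤ e / 2`.
    refine ⟨_, _, ((h.sum h).verify 4).comap f, ?_, ?_⟩
    all_goals
      rw [← NNReal.coe_le_coe] at he hc hδ ⊢
      push_cast at he hc hδ ⊢
      have hp : (1 : ℝ) ≤ 2 ^ j := one_le_pow₀ (by norm_num)
      have he0 := e.coe_nonneg
      have hc0 := c.coe_nonneg
      have ht0 : (0 : ℝ) ≤ t := t.cast_nonneg
      have he1 : (e : ℝ) ≤ 1 / 32 :=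
        (le_mul_of_one_le_right he0 hp).trans (he.trans hδ)
      rw [pow_succ (2 : ℝ) j]
    · have : ((e : ℝ) + e) * ((2⁻¹ : ℝ) ^ 4 + (e + e)) ≤ e / 2 := by nlinarith
      calc _ ≤ (e : ℝ) / 2 * (2 ^ j * 2) := by gcongr
        _ = e * 2 ^ j := by ring
        _ ≤ _ := he
    -- The error decays as fast as the cost grows, so the expected rerun cost stays bounded
    -- independently of `j`.
    · have h1 : (e : ℝ) * c ≤ (2 * t + 16) / 16 := by
        have hc' : (c : ℝ) ≤ 2 * (2 * t + 16) * 2 ^ j := by linarith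
        calc (e : ℝ) * c ≤ e * (2 * (2 * t + 16) * 2 ^ j) := by gcongr
          _ = 2 * (2 * t + 16) * (e * 2 ^ j) := by ring
          _ ≤ 2 * (2 * t + 16) * (1 / 32) := by
              gcongr
              exact he.trans hδ
          _ = _ := by ring
      nlinarith

end Scheme

/-! ### The two bounds -/

/-- Markov's inequality turns a bound on the expected cost into a bound on the height. -/
theorem Rpub_le_of_hasScheme {n k H : ℕ} {e c : ℝ≥0} {ε : ℝ} (hε : 0 ≤ ε)
    (h : HasScheme (Fin n → Bool) (Fin k) e c) (hH : 0 < H) (he : e + c / H ≤ ε) :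
    Rpub ε (directSum k (EQ n)) ≤ H := by
  obtain ⟨P, -, herr, hcost⟩ := h
  let d : Fin k → Bool := fun _ => true
  refine iInf₂_le_of_le (P.map (Protocol.truncate d H)) ?_ ?_
  · intro x y
    rw [toOuterMeasure_eq_expect, expect_map]
    have hH0 : (H : ℝ≥0∞) ≠ 0 := by exact_mod_cast hH.ne'
    have hf : directSum k (EQ n) x y = eqVec x y := by
      funext i
      simp [directSum, EQ, eqVec]
    calc _ ≤ expect P fun T => wrong x y T + (T.cost x y : ℝ≥0∞) * (H : ℝ≥0∞)⁻¹ := by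
          refine expect_mono fun T _ => ?_
          by_cases hT : T.cost x y ≤ H
          · refine le_trans ?_ le_self_add
            rw [Set.mem_ofPred_eq, T.eval_truncate d x y H hT, hf, wrong]
            split_ifs <;> simp_all
          · refine le_trans ?_ le_add_self
            have : (1 : ℝ≥0∞) ≤ (T.cost x y : ℝ≥0∞) * (H : ℝ≥0∞)⁻¹ := by
              rw [← ENNReal.mul_inv_cancel hH0 (ENNReal.natCast_ne_top H)]
              gcongr
              omega
            split_ifs
            · exact this
            · exact zero_le
      _ ≤ e + c * (H : ℝ≥0∞)⁻¹ := by
          rw [expect_add, expect_mul_const]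
          gcongr
          · exact herr x y
          · exact hcost x y
      _ = ((e + c / H : ℝ≥0) : ℝ≥0∞) := by
          have : (H : ℝ≥0) ≠ 0 := by exact_mod_cast hH.ne'
          rw [ENNReal.coe_add, ENNReal.coe_div this, ENNReal.coe_natCast, div_eq_mul_inv]
      _ ≤ ENNReal.ofReal ε := by
          rw [ENNReal.ofReal, ENNReal.coe_le_coe, ← NNReal.coe_le_coe, Real.coe_toNNReal _ hε]
          exact_mod_cast he
  · refine iSup₂_le fun T hT => ?_
    simp only [PMF.mem_support_map_iff] at hT
    obtain ⟨S, -, rfl⟩ := hT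
    exact_mod_cast S.height_truncate_le d H

theorem exists_Rpub_directSum_EQ_le {ε : ℝ} (hε : 0 < ε) :
    ∃ C : ℕ, ∀ n k : ℕ, Rpub ε (directSum k (EQ n)) ≤ (C : ℕ∞) * (k : ℕ∞) := by
  obtain ⟨t₀, ht₀⟩ := exists_pow_lt_of_lt_one (half_pos hε) (show (2⁻¹ : ℝ) < 1 by norm_num)
  obtain ⟨t, ht5, hte⟩ : ∃ t : ℕ, 5 ≤ t ∧ (2⁻¹ : ℝ) ^ t ≤ ε / 2 :=
    ⟨max 5 t₀, le_max_left _ _, (pow_le_pow_of_le_one (by norm_num) (by norm_num)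
      (le_max_right _ _)).trans ht₀.le⟩
  obtain ⟨N, hN⟩ := exists_nat_ge (2 / ε)
  -- Half of `ε` covers the error of the scheme, half the truncation. Rounding `k` up to a power of
  -- two at most `2 * k` gives expected cost at most `4 * (2 * t + 16) * k`, and Markov loses the
  -- factor `N ≥ 2 / ε`.
  refine ⟨N * (4 * (2 * t + 16)), fun n k => ?_⟩
  rcases Nat.eq_zero_or_pos k with rfl | hk
  · refine iInf₂_le_of_le (PMF.pure (.leaf fun _ => true)) ?_ ?_
    · intro x y
      rw [toOuterMeasure_eq_expect, expect_pure]
      have : (fun _ => true) = directSum 0 (EQ n) x y := Subsingleton.elim _ _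
      simp [this]
    · simp [PublicCoinProtocol.height, Protocol.height]
  · obtain ⟨e, c, h, he, hc⟩ :=
      exists_hasScheme_two_pow (α := Fin n → Bool) ht5 (Nat.clog 2 k)
    have hpow : 2 ^ Nat.clog 2 k ≤ 2 * k := by
      rcases Nat.lt_or_ge 1 k with hk1 | hk1
      · have h1 := Nat.pow_pred_clog_lt_self one_lt_two hk1
        have h2 := Nat.clog_pos one_lt_two hk1
        obtain ⟨m, hm⟩ := Nat.exists_eq_succ_of_ne_zero h2.ne'
        rw [hm, Nat.pred_succ] at h1
        rw [hm, pow_succ]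
        omega
      · simp [Nat.clog_of_right_le_one hk1]
        omega
    have hNpos : (0 : ℝ) < N := (div_pos two_pos hε).trans_le hN
    have hN0 : 0 < N := by exact_mod_cast hNpos
    have h' : HasScheme (Fin n → Bool) (Fin k) e c :=
      h.comap (Fin.castLEEmb (Nat.le_pow_clog one_lt_two k))
    have := Rpub_le_of_hasScheme (H := N * (4 * (2 * t + 16)) * k) hε.le h'
      (by positivity) ?_
    · exact_mod_cast this
    · have hp : (1 : ℝ) ≤ 2 ^ Nat.clog 2 k := one_le_pow₀ (by norm_num)
      have hpow' : (2 : ℝ) ^ Nat.clog 2 k ≤ 2 * k := by exact_mod_cast hpow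
      have hk' : (0 : ℝ) < k := by exact_mod_cast hk
      rw [← NNReal.coe_le_coe] at he hc
      push_cast at he hc ⊢
      have he' : (e : ℝ) ≤ ε / 2 :=
        (le_mul_of_one_le_right e.coe_nonneg hp).trans (he.trans hte)
      have hc' : (c : ℝ) ≤ 4 * (2 * t + 16) * k := by
        have ht0 : (0 : ℝ) ≤ t := t.cast_nonneg
        have : 2 * (2 * (t : ℝ) + 16) * 2 ^ Nat.clog 2 k ≤ 2 * (2 * t + 16) * (2 * k) := by
          gcongr
        linarith
      have hNε : 1 ≤ (ε / 2) * N := by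
        rw [div_le_iff₀ hε] at hN
        linarith
      have : (c : ℝ) / (N * (4 * (2 * t + 16)) * k) ≤ ε / 2 := by
        rw [div_le_iff₀ (by positivity)]
        calc (c : ℝ) ≤ 1 * (4 * (2 * t + 16) * k) := by rw [one_mul]; exact hc'
          _ ≤ (ε / 2 * N) * (4 * (2 * t + 16) * k) := by gcongr
          _ = _ := by ring
      linarith

/-- With one input fixed, all `2 ^ k` outputs occur, so fewer than `k` bits do not suffice. -/
theorem le_Rpub_directSum_EQ {ε : ℝ} (hε : ε < 1 / 2) {n : ℕ} (hn : 1 ≤ n) (k : ℕ) :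
    (k : ℕ∞) ≤ Rpub ε (directSum k (EQ n)) := by
  refine le_iInf₂ fun P hP => ?_
  by_contra hlt
  rw [not_le] at hlt
  have hheight : ∀ T ∈ P.support, T.height < k := fun T hT => by
    exact_mod_cast (le_iSup₂ (f := fun T (_ : T ∈ P.support) => (T.height : ℕ∞)) T hT).trans_lt hlt
  -- Bob encodes the desired output `s` by constant strings; `1 ≤ n` makes the two constant strings
  -- distinct.
  let x : Fin k → Fin n → Bool := fun _ _ => true
  let y : (Fin k → Bool) → Fin k → Fin n → Bool := fun s i _ => s i
  have hf : ∀ s, directSum k (EQ n) x (y s) = s := by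
    intro s
    funext i
    have : (x i = y s i) ↔ s i = true :=
      ⟨fun h => (congrFun h ⟨0, hn⟩).symm, fun h => funext fun _ => h.symm⟩
    simp only [directSum, EQ, this]
    simp
  let right : (Fin k → Bool) → Protocol (Fin k → Fin n → Bool) (Fin k → Fin n → Bool)
      (Fin k → Bool) → ℝ≥0∞ := fun s T => if T.eval x (y s) = s then 1 else 0
  have hright : expect P (fun T => ∑ s, right s T) ≤ 2 ^ (k - 1) := by
    rw [← expect_const P (2 ^ (k - 1))]
    refine expect_mono fun T hT => ?_
    obtain ⟨L, hL, hmem⟩ := T.exists_finset_outputs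
    have hsub : (Finset.univ.filter fun s => T.eval x (y s) = s) ⊆ L := by
      intro s hs
      rw [← (Finset.mem_filter.1 hs).2]
      exact hmem _ _
    have hcard : (Finset.univ.filter fun s => T.eval x (y s) = s).card ≤ 2 ^ (k - 1) :=
      (Finset.card_le_card hsub).trans (hL.trans (Nat.pow_le_pow_right two_pos
        (Nat.le_sub_one_of_lt (hheight T hT))))
    simp only [right, Finset.sum_boole]
    exact_mod_cast hcard
  have hwrong : ∀ s, 1 ≤ ENNReal.ofReal ε + expect P (right s) := by
    intro s
    have h := hP x (y s)
    rw [toOuterMeasure_eq_expect, hf] at h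
    refine le_trans ?_ (add_le_add h le_rfl)
    rw [← expect_add, ← expect_const P 1]
    refine expect_mono fun T _ => ?_
    by_cases hT : T.eval x (y s) = s <;> simp [right, hT]
  have hsum : ((2 : ℝ≥0∞) ^ k) ≤ 2 ^ k * ENNReal.ofReal ε + 2 ^ (k - 1) := by
    calc (2 : ℝ≥0∞) ^ k = ∑ _s : Fin k → Bool, 1 := by simp
      _ ≤ ∑ s, (ENNReal.ofReal ε + expect P (right s)) := Finset.sum_le_sum fun s _ => hwrong s
      _ = 2 ^ k * ENNReal.ofReal ε + expect P (fun T => ∑ s, right s T) := by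
          rw [Finset.sum_add_distrib, expect_sum]
          simp
      _ ≤ _ := by gcongr
  have hk : 0 < k := by
    obtain ⟨T, hT⟩ := P.support_nonempty
    exact (Nat.zero_le _).trans_lt (hheight T hT)
  obtain ⟨m, rfl⟩ := Nat.exists_eq_succ_of_ne_zero hk.ne'
  have hr : ((2 : ℝ≥0) ^ (m + 1)) ≤ 2 ^ (m + 1) * ε.toNNReal + 2 ^ m := by
    rw [ENNReal.ofReal] at hsum
    exact_mod_cast hsum
  rw [← NNReal.coe_le_coe] at hr
  push_cast [Real.coe_toNNReal'] at hr
  -- `ENNReal.ofReal` truncates at zero, and `ε` may be negative here.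
  have hmax : max ε 0 < 1 / 2 := max_lt hε (by norm_num)
  have hpos : (0 : ℝ) < 2 ^ m := by positivity
  rw [pow_succ] at hr
  nlinarith

end

end CommComplexity

theorem mainTheorem5 :
    ∀ ε : ℝ, 0 < ε → ε < 1 / 2 →
      ∃ C : ℕ, ∀ n k : ℕ,
        CommComplexity.Rpub ε (CommComplexity.directSum k (CommComplexity.EQ n)) ≤
            (C : ℕ∞) * (k : ℕ∞) ∧
          (1 ≤ n →
            (k : ℕ∞) ≤
              CommComplexity.Rpub ε (CommComplexity.directSum k (CommComplexity.EQ n))) := by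
  intro ε hε hε'
  obtain ⟨C, hC⟩ := CommComplexity.exists_Rpub_directSum_EQ_le hε
  exact ⟨C, fun n k => ⟨hC n k, fun hn => CommComplexity.le_Rpub_directSum_EQ hε' hn k⟩⟩
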